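/- Let $H$ be a group, let $B$ be a normal subgroup of $H$ of prime index $p$, and let $\theta : H \to B$ be an isomorphism. Let $G = H*_\theta$ be the HNN extension of $H$ relative to $\theta$, that is, the group generated by $H$ and a letter $t$ subject to the relations of $H$ and $tht^{-1} = \theta(h)$ for all $h \in H$, and assume that $G$ is finitely generated. For a finite generating set $S$ of $G$ let $\ell_S(g)$ be the minimal length of a word in $S \cup S^{-1}$ representing $g \in G$, let $\omega(G,S) = \lim_{n\to\infty} \#\{g \in G : \ell_S(g) \le n\}^{1/n}$ (this limit exists), and let $\Omega(G) = \inf_S \omega(G,S)$, the infimum being over all finite generating sets $S$ of $G$. For an integer $k \ge 1$ let $\omega_k$ be the unique positive root of $$T_k(x) = x^{k+1} - x^k - 2x^{k-1} - \dots - 2x - 2.$$ Then $$\Omega(G) \ge \frac{1+\sqrt5}{2} \quad \text{if } p = 2, \qquad \Omega(G) \ge \omega_k \quad \text{if } p = 2k+1.$$ -/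

import Mathlib

open Filter Topology

noncomputable section

namespace GroupGrowth

variable {G : Type*} [Group G]

/-- `IsWord S l` says that `l` is a word in the alphabet `S ∪ S⁻¹`. -/
def IsWord (S : Set G) (l : List G) : Prop :=
  ∀ x ∈ l, x ∈ S ∨ x⁻¹ ∈ S

/-- The length of `g` with respect to a generating set `S`: the minimal length of a word in
`S ∪ S⁻¹` whose product is `g`. -/
def wordLength (S : Set G) (g : G) : ℕ :=
  sInf {n : ℕ | ∃ l : List G, IsWord S l ∧ l.prod = g ∧ l.length = n}

/-- The ball of radius `n` around the identity for the word length of `S`. -/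
def ball (S : Set G) (n : ℕ) : Set G :=
  {g : G | wordLength S g ≤ n}

/-- The growth function: the number of elements of the ball of radius `n`. -/
def growthFunction (S : Set G) (n : ℕ) : ℕ :=
  (ball S n).ncard

/-- The exponential growth rate `lim F(n)^(1/n)` of `G` with respect to a finite generating
set `S`. The limit exists, see `tendsto_growthRate`. -/
def growthRate (S : Set G) : ℝ :=
  limUnder atTop fun n : ℕ => (growthFunction S n : ℝ) ^ (1 / (n : ℝ))

variable (G) in
/-- The minimal exponential growth rate: the infimum of the exponential growth rates over all
finite generating sets of the finitely generated group `G`. -/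
def minGrowthRate : ℝ :=
  sInf {r : ℝ | ∃ S : Set G, S.Finite ∧ Subgroup.closure S = ⊤ ∧ growthRate S = r}

theorem exists_word {S : Set G} (hS : Subgroup.closure S = ⊤) (g : G) :
    ∃ l : List G, IsWord S l ∧ l.prod = g := by
  have hg : g ∈ Subgroup.closure S := by rw [hS]; trivial
  rw [← Subgroup.mem_toSubmonoid, Subgroup.closure_toSubmonoid] at hg
  obtain ⟨l, hl, h⟩ := Submonoid.exists_list_of_mem_closure hg
  exact ⟨l, fun x hx => by simpa using hl x hx, h⟩

theorem exists_word_length_eq {S : Set G} (hS : Subgroup.closure S = ⊤) (g : G) :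
    ∃ l : List G, IsWord S l ∧ l.prod = g ∧ l.length = wordLength S g := by
  have hne : {n : ℕ | ∃ l : List G, IsWord S l ∧ l.prod = g ∧ l.length = n}.Nonempty := by
    obtain ⟨l, hl, hg⟩ := exists_word hS g
    exact ⟨l.length, l, hl, hg, rfl⟩
  exact Nat.sInf_mem hne

theorem mem_ball_iff {S : Set G} (hS : Subgroup.closure S = ⊤) (n : ℕ) (g : G) :
    g ∈ ball S n ↔ ∃ l : List G, IsWord S l ∧ l.prod = g ∧ l.length ≤ n := by
  constructor
  · intro hg
    obtain ⟨l, hl, h, hn⟩ := exists_word_length_eq hS g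
    exact ⟨l, hl, h, hn.trans_le hg⟩
  · rintro ⟨l, hl, h, hn⟩
    exact (Nat.sInf_le ⟨l, hl, h, rfl⟩ : wordLength S g ≤ l.length).trans hn

theorem finite_ball {S : Set G} (hfin : S.Finite) (hS : Subgroup.closure S = ⊤) (n : ℕ) :
    (ball S n).Finite := by
  have hT : {x : G | x ∈ S ∨ x⁻¹ ∈ S}.Finite := by
    have : {x : G | x ∈ S ∨ x⁻¹ ∈ S} = S ∪ (fun x : G => x⁻¹) '' S := by
      ext x
      simp
    rw [this]
    exact hfin.union (hfin.image _)
  have : Finite {x : G // x ∈ S ∨ x⁻¹ ∈ S} := hT.to_subtype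
  refine ((List.finite_length_le {x : G // x ∈ S ∨ x⁻¹ ∈ S} n).image
    fun l => (l.map Subtype.val).prod).subset ?_
  intro g hg
  obtain ⟨l, hl, h, hn⟩ := (mem_ball_iff hS n g).1 hg
  refine ⟨l.attach.map fun x => ⟨x.1, hl x.1 x.2⟩, by simpa using hn, ?_⟩
  simp [List.map_map, Function.comp_def, h]

theorem one_le_growthFunction {S : Set G} (hfin : S.Finite) (hS : Subgroup.closure S = ⊤)
    (n : ℕ) : 1 ≤ growthFunction S n := by
  have h1 : (1 : G) ∈ ball S n :=
    (mem_ball_iff hS n 1).2 ⟨[], by simp [IsWord], by simp, by simp⟩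
  exact (Set.ncard_pos (finite_ball hfin hS n)).2 ⟨1, h1⟩

theorem growthFunction_add_le {S : Set G} (hfin : S.Finite) (hS : Subgroup.closure S = ⊤)
    (m n : ℕ) : growthFunction S (m + n) ≤ growthFunction S m * growthFunction S n := by
  have hsub : ball S (m + n) ⊆ (fun q : G × G => q.1 * q.2) '' (ball S m ×ˢ ball S n) := by
    intro g hg
    obtain ⟨l, hl, h, hn⟩ := (mem_ball_iff hS _ g).1 hg
    refine ⟨((l.take m).prod, (l.drop m).prod), ⟨?_, ?_⟩, ?_⟩
    · exact (mem_ball_iff hS _ _).2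
        ⟨_, fun x hx => hl x (List.mem_of_mem_take hx), rfl, by simp⟩
    · exact (mem_ball_iff hS _ _).2
        ⟨_, fun x hx => hl x (List.mem_of_mem_drop hx), rfl, by simp; omega⟩
    · simp [h]
  have hf := (finite_ball hfin hS m).prod (finite_ball hfin hS n)
  calc (ball S (m + n)).ncard
      ≤ ((fun q : G × G => q.1 * q.2) '' (ball S m ×ˢ ball S n)).ncard :=
        Set.ncard_le_ncard hsub (hf.image _)
    _ ≤ (ball S m ×ˢ ball S n).ncard := Set.ncard_image_le hf
    _ = _ := Set.ncard_prod

/-- The limit in the definition of the exponential growth rate exists. -/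
theorem tendsto_growthRate {S : Set G} (hfin : S.Finite) (hS : Subgroup.closure S = ⊤) :
    Tendsto (fun n : ℕ => (growthFunction S n : ℝ) ^ (1 / (n : ℝ))) atTop
      (𝓝 (growthRate S)) := by
  have hpos : ∀ n, (1 : ℝ) ≤ growthFunction S n := fun n => by
    exact_mod_cast one_le_growthFunction hfin hS n
  have hsub : Subadditive fun n => Real.log (growthFunction S n) := by
    intro m n
    have h0 := hpos m
    have h1 := hpos n
    have h2 := hpos (m + n)
    rw [← Real.log_mul (by positivity) (by positivity)]
    refine Real.log_le_log (by positivity) ?_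
    exact_mod_cast growthFunction_add_le hfin hS m n
  have hbdd : BddBelow (Set.range fun n : ℕ => Real.log (growthFunction S n) / n) := by
    refine ⟨0, ?_⟩
    rintro _ ⟨n, rfl⟩
    exact div_nonneg (Real.log_nonneg (hpos n)) (Nat.cast_nonneg n)
  have hlim := (Real.continuous_exp.tendsto _).comp (hsub.tendsto_lim hbdd)
  have heq : (fun n : ℕ => (growthFunction S n : ℝ) ^ (1 / (n : ℝ))) =
      Real.exp ∘ fun n : ℕ => Real.log (growthFunction S n) / n := by
    funext n
    have h0 := hpos n
    rw [Real.rpow_def_of_pos (by linarith), Function.comp_apply, mul_one_div]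
  exact tendsto_nhds_limUnder ⟨_, by rw [heq]; exact hlim⟩

open Polynomial in
/-- The polynomial `T_k(x) = x^(k+1) - x^k - 2 x^(k-1) - ... - 2 x - 2`. -/
def rootPoly (k : ℕ) : ℝ[X] :=
  X ^ (k + 1) - X ^ k - ∑ i ∈ Finset.range k, 2 * X ^ i

theorem eval_rootPoly (k : ℕ) (x : ℝ) :
    (rootPoly k).eval x = x ^ (k + 1) - x ^ k - ∑ i ∈ Finset.range k, 2 * x ^ i := by
  simp [rootPoly, Polynomial.eval_finsetSum]

theorem existsUnique_pos_root (k : ℕ) : ∃! x : ℝ, 0 < x ∧ (rootPoly k).IsRoot x := by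
  have hlt : ∀ x y : ℝ, 0 < x → x < y → (rootPoly k).eval x = 0 →
      (rootPoly k).eval y = 0 → False := by
    intro x y hx hxy h1 h2
    have hy : 0 < y := hx.trans hxy
    rw [eval_rootPoly] at h1 h2
    have key : ∀ i, i < k + 1 → y ^ i * x ^ (k + 1) < x ^ i * y ^ (k + 1) := by
      intro i hi
      obtain ⟨j, hj⟩ := Nat.exists_eq_add_of_lt hi
      have hp : x ^ (j + 1) < y ^ (j + 1) := pow_lt_pow_left₀ hxy hx.le (by omega)
      have e : k + 1 = i + (j + 1) := by omega
      rw [e, pow_add x i (j + 1), pow_add y i (j + 1)]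
      have : 0 < x ^ i * y ^ i := by positivity
      nlinarith [mul_lt_mul_of_pos_left hp this]
    have hs : (∑ i ∈ Finset.range k, 2 * y ^ i) * x ^ (k + 1) ≤
        (∑ i ∈ Finset.range k, 2 * x ^ i) * y ^ (k + 1) := by
      rw [Finset.sum_mul, Finset.sum_mul]
      refine Finset.sum_le_sum fun i hi => ?_
      have := key i (by have := Finset.mem_range.1 hi; omega)
      nlinarith
    have hk := key k (by omega)
    have e1 : x ^ (k + 1) = x ^ k + ∑ i ∈ Finset.range k, 2 * x ^ i := by linarith
    have e2 : y ^ (k + 1) = y ^ k + ∑ i ∈ Finset.range k, 2 * y ^ i := by linarith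
    have c1 : x ^ (k + 1) * y ^ (k + 1) =
        (x ^ k + ∑ i ∈ Finset.range k, 2 * x ^ i) * y ^ (k + 1) := by rw [← e1]
    have c2 : y ^ (k + 1) * x ^ (k + 1) =
        (y ^ k + ∑ i ∈ Finset.range k, 2 * y ^ i) * x ^ (k + 1) := by rw [← e2]
    nlinarith
  have hex : ∃ x : ℝ, 0 < x ∧ (rootPoly k).eval x = 0 := by
    have h1 : (rootPoly k).eval 1 ≤ 0 := by
      rw [eval_rootPoly]
      simp
    have h3 : 0 ≤ (rootPoly k).eval 3 := by
      rw [eval_rootPoly, ← Finset.mul_sum, geom_sum_eq (by norm_num)]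
      have : (0 : ℝ) < 3 ^ k := by positivity
      rw [pow_succ]
      linarith
    obtain ⟨x, hx, hx0⟩ := intermediate_value_Icc (by norm_num : (1 : ℝ) ≤ 3)
      (rootPoly k).continuous.continuousOn ⟨h1, h3⟩
    exact ⟨x, by linarith [hx.1], hx0⟩
  obtain ⟨x, hx, hx0⟩ := hex
  refine ⟨x, ⟨hx, hx0⟩, ?_⟩
  rintro y ⟨hy, hy0⟩
  rcases lt_trichotomy x y with h | h | h
  · exact (hlt x y hx h hx0 hy0).elim
  · exact h.symm
  · exact (hlt y x hy h hy0 hx0).elim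

/-- The number `ω_k`: the unique positive root of `T_k`. -/
def omegaRoot (k : ℕ) : ℝ :=
  (existsUnique_pos_root k).choose

end GroupGrowth

end

/-!
The ascending HNN extension acts on its Bass–Serre tree and fixes an end. Inside any finite
generating set (up to inversion) there are a hyperbolic `a` and an element `b` whose actions diverge
at a vertex `v`: otherwise the group would fix a second end. Elements that map the descendants of
`v` into the cones of distinct children of `v` generate a free monoid by ping-pong, and a free
monoid on elements of lengths `n i` gives growth rate at least `1 / z` as soon as `∑ z ^ n i ≥ 1`.

The elements `a` and `b * a` give the golden ratio. If the index of the base group is `2 k + 1`,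
then an elliptic `b` permutes the children of `v` that it moves in cycles of length at least
`2 k + 1`, and the elements `b ^ e * a` with `|e| ≤ k` give `ω_k`. If `b` is hyperbolic with the
translation length of `a`, then `b * a⁻¹` is elliptic and plays the same role; for `k = 1` the free
pair `a`, `b` already gives `ω_1 = 2`. In the remaining case the translation lengths differ and
`k ≥ 2`, and suitable words in `a` and `b` give more than `1 + √2`, the limit of the `ω_k`: it is
enough to reach `29 / 12`, a convergent of that limit from above.
-/

namespace GroupGrowth

section Growth

variable {G : Type*} [Group G] {S : Set G}

theorem wordLength_prod_le_length {l : List G} (hl : IsWord S l) :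
    wordLength S l.prod ≤ l.length :=
  Nat.sInf_le ⟨l, hl, rfl, rfl⟩

theorem wordLength_mul_le (hS : Subgroup.closure S = ⊤) (x y : G) :
    wordLength S (x * y) ≤ wordLength S x + wordLength S y := by
  obtain ⟨l, hl, rfl, hlx⟩ := exists_word_length_eq hS x
  obtain ⟨l', hl', rfl, hly⟩ := exists_word_length_eq hS y
  rw [← hlx, ← hly, ← List.prod_append, ← List.length_append]
  exact wordLength_prod_le_length fun z hz => (List.mem_append.1 hz).elim (hl z) (hl' z)

theorem wordLength_list_prod_le (hS : Subgroup.closure S = ⊤) (l : List G) :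
    wordLength S l.prod ≤ (l.map (wordLength S)).sum := by
  induction l with
  | nil => exact wordLength_prod_le_length (l := []) (by simp [IsWord])
  | cons x l ih =>
    rw [List.prod_cons, List.map_cons, List.sum_cons]
    exact (wordLength_mul_le hS x _).trans (by gcongr)

theorem wordLength_lift_le_norm {α : Type*} [DecidableEq α] {f : α → G}
    (hf : ∀ i, f i ∈ S ∨ (f i)⁻¹ ∈ S) (x : FreeGroup α) :
    wordLength S (FreeGroup.lift f x) ≤ x.norm := by
  conv_lhs => rw [← FreeGroup.mk_toWord (x := x)]
  rw [FreeGroup.lift_mk, FreeGroup.norm, ← List.length_map]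
  refine wordLength_prod_le_length fun g hg => ?_
  obtain ⟨⟨i, b⟩, -, rfl⟩ := List.mem_map.1 hg
  cases b
  · simpa using (hf i).symm
  · simpa using hf i

theorem summable_growthFunction_mul_pow (hfin : S.Finite) (hS : Subgroup.closure S = ⊤) {z : ℝ}
    (hz : 0 < z) (hlt : growthRate S < 1 / z) :
    Summable fun n => (growthFunction S n : ℝ) * z ^ n := by
  obtain ⟨r, hr, hrz⟩ := exists_between hlt
  have hr0 : 0 ≤ r :=
    (ge_of_tendsto' (tendsto_growthRate hfin hS) fun n => by positivity).trans hr.le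
  have hgeom : Summable fun n => (r * z) ^ n :=
    summable_geometric_of_lt_one (by positivity) ((lt_div_iff₀ hz).1 hrz)
  refine .of_norm_bounded_eventually_nat hgeom ?_
  filter_upwards [(tendsto_growthRate hfin hS).eventually_lt_const hr, eventually_gt_atTop 0]
    with n hn hn0
  have hF : (growthFunction S n : ℝ) ≤ r ^ n := by
    rw [← Real.rpow_natCast, ← Real.rpow_inv_le_iff_of_pos (by positivity) hr0 (by positivity),
      ← one_div]
    exact hn.le
  rw [Real.norm_of_nonneg (by positivity), mul_pow]
  gcongr

theorem summable_pow_wordLength (hfin : S.Finite) (hS : Subgroup.closure S = ⊤) {z : ℝ}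
    (hz : 0 < z) (hlt : growthRate S < 1 / z) : Summable fun g : G => z ^ wordLength S g := by
  classical
  refine summable_of_sum_le (c := ∑' n, (growthFunction S n : ℝ) * z ^ n)
    (fun g => by positivity) fun u => ?_
  rw [Finset.sum_comp (fun n => z ^ n) (wordLength S)]
  refine le_trans (Finset.sum_le_sum fun n _ => ?_)
    ((summable_growthFunction_mul_pow hfin hS hz hlt).sum_le_tsum _ fun n _ => by positivity)
  rw [nsmul_eq_mul]
  gcongr
  rw [growthFunction, ← Set.ncard_coe_finset]
  exact Set.ncard_le_ncard (fun g hg => (Finset.mem_filter.1 hg).2.le) (finite_ball hfin hS n)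

theorem sum_lt_one_of_summable_list_prod {ι : Type*} [Fintype ι] {f : ι → ℝ}
    (hf : Summable fun l : List ι => (l.map f).prod) : ∑ i, f i < 1 := by
  have hpow : Summable fun n : ℕ => (∑ i, f i) ^ n := by
    refine ((List.equivSigmaTuple.symm.summable_iff.2 hf).sigma).congr fun n => ?_
    simp [tsum_fintype, Fintype.sum_pow, List.equivSigmaTuple, Function.comp_def, List.prod_ofFn]
  by_contra! hle
  exact one_ne_zero <| (summable_const_iff (1 : ℝ)).1 <|
    hpow.of_nonneg_of_le (fun _ => zero_le_one) fun n => one_le_pow₀ hle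

/-- The elements `g i` freely generate a submonoid: distinct words in them have distinct
products. -/
def IsFreeFamily {M ι : Type*} [Monoid M] (g : ι → M) : Prop :=
  Function.Injective fun l : List ι => (l.map g).prod

theorem one_div_le_growthRate (hfin : S.Finite) (hS : Subgroup.closure S = ⊤)
    {ι : Type*} [Fintype ι] {g : ι → G} (hg : IsFreeFamily g) {n : ι → ℕ}
    (hn : ∀ i, wordLength S (g i) ≤ n i) {z : ℝ} (hz : 0 < z) (hz1 : z ≤ 1)
    (hsum : 1 ≤ ∑ i, z ^ n i) : 1 / z ≤ growthRate S := by
  by_contra! hlt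
  have hwords := (summable_pow_wordLength hfin hS hz hlt).comp_injective hg
  have hle (l : List ι) : (l.map fun i => z ^ n i).prod ≤ z ^ wordLength S (l.map g).prod := by
    have hpow : (l.map fun i => z ^ n i).prod = z ^ (l.map n).sum := by
      induction l with
      | nil => simp
      | cons i l ih => simp [pow_add, ih]
    rw [hpow]
    refine pow_le_pow_of_le_one hz.le hz1 ((wordLength_list_prod_le hS _).trans ?_)
    rw [List.map_map]
    exact List.sum_le_sum fun i _ => hn i
  refine (sum_lt_one_of_summable_list_prod (hwords.of_nonneg_of_le (fun l => ?_) hle)).not_ge hsum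
  exact List.prod_nonneg fun x hx => by
    obtain ⟨i, -, rfl⟩ := List.mem_map.1 hx
    positivity

theorem IsFreeFamily.conj {ι : Type*} {g : ι → G} (hg : IsFreeFamily g) (v : G) :
    IsFreeFamily fun i => v * g i * v⁻¹ := by
  have hprod (l : List ι) :
      (l.map fun i => v * g i * v⁻¹).prod = MulAut.conj v (l.map g).prod := by
    simp [map_list_prod, Function.comp_def]
  unfold IsFreeFamily
  simpa only [hprod, Function.comp_def] using (MulAut.conj v).injective.comp hg

/-- A prefix code: the words of the family `w` are nonempty and none is a prefix of another one. -/
def IsPrefixCode {ι κ : Type*} (w : κ → List ι) : Prop :=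
  (∀ i, w i ≠ []) ∧ ∀ i j, w i <+: w j → i = j

theorem IsPrefixCode.injective_flatten {ι κ : Type*} {w : κ → List ι} (hw : IsPrefixCode w) :
    Function.Injective fun l : List κ => (l.map w).flatten := by
  intro l
  induction l with
  | nil =>
    rintro (_ | ⟨j, l'⟩) h
    · rfl
    · simp [hw.1] at h
  | cons i l ih =>
    rintro (_ | ⟨j, l'⟩) h
    · simp [hw.1] at h
    simp only [List.map_cons, List.flatten_cons] at h
    obtain rfl : i = j := by
      rcases List.prefix_or_prefix_of_prefix (List.prefix_append (w i) _)
        (h ▸ List.prefix_append (w j) _) with hij | hji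
      · exact hw.2 i j hij
      · exact (hw.2 j i hji).symm
    rw [ih (List.append_cancel_left h)]

theorem IsFreeFamily.comp_isPrefixCode {M ι κ : Type*} [Monoid M] {g : ι → M} {w : κ → List ι}
    (hg : IsFreeFamily g) (hw : IsPrefixCode w) : IsFreeFamily fun i => ((w i).map g).prod := by
  have hprod (l : List κ) :
      (l.map fun i => ((w i).map g).prod).prod = ((l.map w).flatten.map g).prod := by
    induction l <;> simp_all
  unfold IsFreeFamily
  simpa only [hprod, Function.comp_def] using Function.Injective.comp hg hw.injective_flatten

theorem one_div_le_growthRate_of_prefixCode (hfin : S.Finite) (hS : Subgroup.closure S = ⊤)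
    {α ι κ : Type*} [DecidableEq α] [Fintype κ] {f : α → G} (hf : ∀ i, f i ∈ S ∨ (f i)⁻¹ ∈ S)
    {x : ι → FreeGroup α} (hx : IsFreeFamily fun i => FreeGroup.lift f (x i))
    {w : κ → List ι} (hw : IsPrefixCode w) (v : FreeGroup α) {n : κ → ℕ}
    (hn : ∀ i, (v * ((w i).map x).prod * v⁻¹).norm ≤ n i) {z : ℝ} (hz : 0 < z) (hz1 : z ≤ 1)
    (hsum : 1 ≤ ∑ i, z ^ n i) : 1 / z ≤ growthRate S := by
  refine one_div_le_growthRate hfin hS ((hx.comp_isPrefixCode hw).conj (FreeGroup.lift f v))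
    (fun i => ?_) hz hz1 hsum
  have hword : FreeGroup.lift f (v * ((w i).map x).prod * v⁻¹) = FreeGroup.lift f v *
      ((w i).map fun j => FreeGroup.lift f (x j)).prod * (FreeGroup.lift f v)⁻¹ := by
    simp [map_list_prod, Function.comp_def]
  rw [← hword]
  exact (wordLength_lift_le_norm hf _).trans (hn i)

theorem le_minGrowthRate [Group.FG G] {r : ℝ}
    (h : ∀ S : Set G, S.Finite → Subgroup.closure S = ⊤ → r ≤ growthRate S) :
    r ≤ minGrowthRate G := by
  obtain ⟨S, hS, hfin⟩ := Group.fg_iff.1 (inferInstance : Group.FG G)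
  refine le_csInf ⟨_, S, hfin, hS, rfl⟩ ?_
  rintro _ ⟨S, hfin, hS, rfl⟩
  exact h S hfin hS

end Growth

section OmegaRoot

variable {k : ℕ}

theorem omegaRoot_pos (k : ℕ) : 0 < omegaRoot k :=
  (existsUnique_pos_root k).choose_spec.1.1

theorem omegaRoot_pow_succ (k : ℕ) :
    omegaRoot k ^ (k + 1) = omegaRoot k ^ k + ∑ i ∈ Finset.range k, 2 * omegaRoot k ^ i := by
  have hroot : (rootPoly k).eval (omegaRoot k) = 0 := (existsUnique_pos_root k).choose_spec.1.2
  rw [eval_rootPoly] at hroot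
  linarith

theorem omegaRoot_one : omegaRoot 1 = 2 :=
  (existsUnique_pos_root 1).unique (existsUnique_pos_root 1).choose_spec.1
    ⟨two_pos, by rw [Polynomial.IsRoot, eval_rootPoly]; norm_num⟩

theorem one_lt_omegaRoot (hk : 0 < k) : 1 < omegaRoot k := by
  have hx := omegaRoot_pos k
  have hsum : 0 < ∑ i ∈ Finset.range k, 2 * omegaRoot k ^ i :=
    Finset.sum_pos (fun i _ => by positivity) ⟨0, Finset.mem_range.2 hk⟩
  by_contra! hle
  have hpow : omegaRoot k ^ (k + 1) ≤ omegaRoot k ^ k := pow_le_pow_of_le_one hx.le hle k.le_succ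
  linarith [omegaRoot_pow_succ k]

theorem two_mul_inv_omegaRoot_add_sq (k : ℕ) :
    2 * (omegaRoot k)⁻¹ + (omegaRoot k)⁻¹ ^ 2 = 1 + 2 * (omegaRoot k)⁻¹ ^ (k + 2) := by
  have hx := omegaRoot_pos k
  have hroot := omegaRoot_pow_succ k
  have hgeom := geom_sum_mul (omegaRoot k) k
  generalize omegaRoot k = x at *
  rw [← Finset.mul_sum] at hroot
  have hmul : x ^ k * (2 * x + 1) = x ^ k * x ^ 2 + 2 := by
    linear_combination (1 - x) * hroot - 2 * hgeom
  rw [inv_pow, inv_pow]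
  field_simp
  linear_combination x ^ 2 * hmul

theorem inv_omegaRoot_add_sum (hk : 0 < k) :
    (omegaRoot k)⁻¹ + 2 * ∑ i ∈ Finset.range k, (omegaRoot k)⁻¹ ^ (i + 2) = 1 := by
  have hne : 1 - (omegaRoot k)⁻¹ ≠ 0 :=
    (sub_pos.2 (inv_lt_one_of_one_lt₀ (one_lt_omegaRoot hk))).ne'
  refine mul_left_cancel₀ hne ?_
  simp only [pow_add, ← Finset.sum_mul]
  linear_combination 2 * (omegaRoot k)⁻¹ ^ 2 * mul_neg_geom_sum (omegaRoot k)⁻¹ k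
    + two_mul_inv_omegaRoot_add_sq k

/-- The numbers `ω_k` increase to `1 + √2`, and `29 / 12` is a convergent of that limit. -/
theorem omegaRoot_le (k : ℕ) : omegaRoot k ≤ 29 / 12 := by
  have hz := inv_pos.2 (omegaRoot_pos k)
  rw [← inv_le_inv₀ (by norm_num) (omegaRoot_pos k)]
  nlinarith [two_mul_inv_omegaRoot_add_sq k, pow_pos hz (k + 2)]

theorem one_le_inv_omegaRoot_add_sum_odd (hk : 0 < k) :
    1 ≤ (omegaRoot k)⁻¹ + (∑ i ∈ Finset.range k, (omegaRoot k)⁻¹ ^ (2 * i + 1)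
      + ∑ i ∈ Finset.range k, (omegaRoot k)⁻¹ ^ (2 * i + 3)) := by
  have hz := inv_pos.2 (omegaRoot_pos k)
  have hz1 := inv_lt_one_of_one_lt₀ (one_lt_omegaRoot hk)
  have hsq := two_mul_inv_omegaRoot_add_sq k
  generalize (omegaRoot k)⁻¹ = z at *
  have hgeom := mul_neg_geom_sum (z ^ 2) k
  have hle : z ^ (2 * k + 1) + z ^ (2 * k + 3) ≤ 2 * z ^ (k + 2) := by
    linarith [pow_le_pow_of_le_one hz.le hz1.le (show k + 2 ≤ 2 * k + 1 by omega),
      pow_le_pow_of_le_one hz.le hz1.le (show k + 2 ≤ 2 * k + 3 by omega)]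
  have hpos : 0 < 1 - z ^ 2 := by nlinarith
  refine le_of_mul_le_mul_left ?_ hpos
  simp only [pow_add _ (2 * _), pow_mul, ← Finset.sum_mul] at hle ⊢
  linear_combination (exp := 1) hle - hsq - (z + z ^ 3) * hgeom

end OmegaRoot

theorem iterate_smul_of_equivariant {G X : Type*} [SMul G X] {p : X → X}
    (hp : ∀ (g : G) x, p (g • x) = g • p x) (n : ℕ) (g : G) (x : X) :
    p^[n] (g • x) = g • p^[n] x :=
  (Function.Semiconj.iterate_right (f := (g • ·)) (fun x => (hp g x).symm) n x).symm

theorem isFreeFamily_of_pingPong {G X ι : Type*} [Group G] [MulAction G X] {g : ι → G}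
    {D : Set X} {C : ι → Set X} {x : X} (hx : x ∈ D) (hxC : ∀ i, x ∉ C i) (hCD : ∀ i, C i ⊆ D)
    (hC : Pairwise fun i j => Disjoint (C i) (C j))
    (hg : ∀ i, Set.MapsTo (g i • ·) D (C i)) : IsFreeFamily g := by
  have hD (l : List ι) : (l.map g).prod • x ∈ D := by
    induction l with
    | nil => simpa using hx
    | cons i l ih => simpa [mul_smul] using hCD i (hg i ih)
  have hhead (i : ι) (l : List ι) : ((i :: l).map g).prod • x ∈ C i := by
    simpa [mul_smul] using hg i (hD l)
  intro l
  induction l with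
  | nil =>
    rintro (_ | ⟨j, l'⟩) h
    · rfl
    · have hone : ((j :: l').map g).prod = 1 := h.symm
      exact (hxC j (by simpa only [hone, one_smul] using hhead j l')).elim
  | cons i l ih =>
    rintro (_ | ⟨j, l'⟩) h
    · have hone : ((i :: l).map g).prod = 1 := h
      exact (hxC i (by simpa only [hone, one_smul] using hhead i l)).elim
    obtain rfl : i = j := by
      by_contra hne
      exact Set.disjoint_left.1 (hC hne) (hhead i l) (by simpa only [h] using hhead j l')
    rw [ih (mul_left_cancel (a := g i) (by simpa using h))]

/-- An action of `G` by automorphisms on the vertices of a tree with a distinguished end that it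
fixes. The tree is encoded by the map `parent` that moves every vertex one step towards that end;
`level` is a Busemann function, and `height g` is the signed distance by which `g` translates away
from the end. -/
structure HoroTree (G X : Type*) [Group G] [MulAction G X] where
  parent : X → X
  level : X → ℤ
  height : G → ℤ
  parent_smul (g : G) (x : X) : parent (g • x) = g • parent x
  level_parent (x : X) : level (parent x) = level x - 1
  level_smul (g : G) (x : X) : level (g • x) = level x + height g
  exists_iterate_parent_eq (x y : X) : ∃ i j, parent^[i] x = parent^[j] y

namespace HoroTree

variable {G X : Type*} [Group G] [MulAction G X] {T : HoroTree G X} {a b g y : G}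
  {c d v x : X}

theorem iterate_parent_smul (T : HoroTree G X) (n : ℕ) (g : G) (x : X) :
    T.parent^[n] (g • x) = g • T.parent^[n] x :=
  iterate_smul_of_equivariant T.parent_smul n g x

theorem level_iterate_parent (T : HoroTree G X) (n : ℕ) (x : X) :
    T.level (T.parent^[n] x) = T.level x - n := by
  induction n with
  | zero => simp
  | succ n ih =>
    rw [Function.iterate_succ_apply', T.level_parent, ih]
    push_cast
    ring

/-- The descendants of the vertex `x`, including `x` itself. -/
def cone (T : HoroTree G X) (x : X) : Set X :=
  {y | ∃ n, T.parent^[n] y = x}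

theorem self_mem_cone (x : X) : x ∈ T.cone x :=
  ⟨0, rfl⟩

theorem cone_subset_cone (hc : c ∈ T.cone v) : T.cone c ⊆ T.cone v := by
  obtain ⟨m, rfl⟩ := hc
  rintro x ⟨n, rfl⟩
  exact ⟨m + n, Function.iterate_add_apply _ _ _ _⟩

theorem cone_subset_cone_parent (c : X) : T.cone c ⊆ T.cone (T.parent c) :=
  cone_subset_cone ⟨1, rfl⟩

theorem smul_mem_cone_smul (g : G) (hx : x ∈ T.cone v) : g • x ∈ T.cone (g • v) := by
  obtain ⟨n, rfl⟩ := hx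
  exact ⟨n, T.iterate_parent_smul n g x⟩

theorem disjoint_cone (hlevel : T.level c = T.level d) (hne : c ≠ d) :
    Disjoint (T.cone c) (T.cone d) := by
  refine Set.disjoint_left.2 ?_
  rintro x ⟨m, rfl⟩ ⟨n, rfl⟩
  rw [T.level_iterate_parent, T.level_iterate_parent] at hlevel
  exact hne (by rw [show m = n by omega])

theorem level_eq_of_parent_eq (hcd : T.parent c = T.parent d) : T.level c = T.level d := by
  have := T.level_parent c
  rw [hcd, T.level_parent] at this
  omega

/-- The element `g` is hyperbolic and its axis, oriented away from the fixed end, passes from the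
parent of `c` to `c`. -/
def Enters (T : HoroTree G X) (g : G) (c : X) : Prop :=
  g • T.parent c ∈ T.cone c

theorem Enters.mapsTo_cone (hg : T.Enters g c) :
    Set.MapsTo (g • ·) (T.cone (T.parent c)) (T.cone c) :=
  fun _ hx => cone_subset_cone hg (smul_mem_cone_smul g hx)

theorem Enters.exists_height_eq (hg : T.Enters g c) :
    ∃ n : ℕ, T.height g = n + 1 ∧ g • T.parent^[n + 1] c = c := by
  obtain ⟨n, hn⟩ := hg
  refine ⟨n, ?_, by rwa [T.iterate_parent_smul] at hn⟩
  have hlevel := congrArg T.level hn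
  rw [T.level_iterate_parent, T.level_smul, T.level_parent] at hlevel
  omega

theorem Enters.height_pos (hg : T.Enters g c) : 0 < T.height g := by
  obtain ⟨n, hn, -⟩ := hg.exists_height_eq
  omega

theorem isFreeFamily_of_enters {ι : Type*} {g : ι → G} {c : ι → X}
    (hg : ∀ i, T.Enters (g i) (c i)) (hv : ∀ i, T.parent (c i) = v)
    (hc : Function.Injective c) : IsFreeFamily g := by
  refine isFreeFamily_of_pingPong (D := T.cone v) (C := fun i => T.cone (c i)) (self_mem_cone v)
    ?_ (fun i => hv i ▸ cone_subset_cone_parent (c i)) ?_ fun i => hv i ▸ (hg i).mapsTo_cone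
  · rintro i ⟨n, hn⟩
    have hlevel := T.level_iterate_parent n v
    rw [hn, ← hv i, T.level_parent] at hlevel
    omega
  · exact fun i j hij =>
      disjoint_cone (level_eq_of_parent_eq ((hv i).trans (hv j).symm)) (hc.ne hij)

theorem Enters.fixes_mul (ha : T.Enters a c) (hy : y • T.parent c = T.parent c) :
    T.Enters (y * a) (y • c) := by
  rw [Enters, T.parent_smul, hy, mul_smul]
  exact smul_mem_cone_smul y ha

theorem Enters.mul (hb : T.Enters b d) (ha : T.Enters a c) (hcd : T.parent c = T.parent d) :
    T.Enters (b * a) d := by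
  rw [Enters, mul_smul, ← hcd]
  exact hb.mapsTo_cone (hcd ▸ cone_subset_cone_parent c ha)

theorem Enters.mul_inv_smul_eq (hb : T.Enters b d) (ha : T.Enters a c)
    (hcd : T.parent c = T.parent d) (hheight : T.height a = T.height b) :
    (b * a⁻¹) • c = d := by
  obtain ⟨m, hm, hc⟩ := ha.exists_height_eq
  obtain ⟨n, hn, hd⟩ := hb.exists_height_eq
  obtain rfl : m = n := by omega
  rw [Function.iterate_succ_apply] at hc hd
  rw [mul_smul, inv_smul_eq_iff.2 hc.symm, hcd, hd]

theorem Enters.mul_inv (hb : T.Enters b d) (ha : T.Enters a c)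
    (hcd : T.parent c = T.parent d) (hheight : T.height a < T.height b) :
    T.Enters (b * a⁻¹) d := by
  obtain ⟨m, hm, hc⟩ := ha.exists_height_eq
  obtain ⟨n, hn, hd⟩ := hb.exists_height_eq
  have hav : a⁻¹ • T.parent d = T.parent^[m + 1] (T.parent d) := by
    rw [inv_smul_eq_iff, ← hcd, ← Function.iterate_succ_apply, Function.iterate_succ_apply',
      ← T.parent_smul, hc]
  refine ⟨n - (m + 1), ?_⟩
  rw [mul_smul, hav, T.iterate_parent_smul, ← Function.iterate_add_apply,
    show n - (m + 1) + (m + 1) = n by omega, ← Function.iterate_succ_apply, hd]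

theorem height_mul (T : HoroTree G X) (x : X) (g h : G) :
    T.height (g * h) = T.height g + T.height h := by
  have := T.level_smul (g * h) x
  rw [mul_smul, T.level_smul, T.level_smul] at this
  omega

theorem height_inv (T : HoroTree G X) (x : X) (g : G) : T.height g⁻¹ = -T.height g := by
  have := T.level_smul g⁻¹ (g • x)
  rw [inv_smul_smul, T.level_smul] at this
  omega

theorem Enters.commutator_smul_eq (hb : T.Enters b d) (ha : T.Enters a c)
    (hcd : T.parent c = T.parent d) : (b * a * b⁻¹ * a⁻¹) • c = d := by
  have hheight : T.height (a * b) = T.height (b * a) := by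
    rw [T.height_mul c, T.height_mul c, add_comm]
  simpa [mul_assoc] using (hb.mul ha hcd).mul_inv_smul_eq (ha.mul hb hcd.symm) hcd hheight

theorem parent_eq_of_smul_eq (hy : y • c = d) (hcd : T.parent c = T.parent d) :
    y • T.parent c = T.parent c := by
  rw [← T.parent_smul, hy, hcd]

/-- No element that fixes a vertex permutes the children of that vertex with a cycle of
length `2, …, N`. -/
def HasNoRotationUpTo (T : HoroTree G X) (N : ℕ) : Prop :=
  ∀ (g : G) (x : X) (i : ℕ), 0 < i → i ≤ N → g • T.parent x = T.parent x → g ^ i • x = x →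
    g • x = x

theorem HasNoRotationUpTo.injective_zpow_smul {N : ℕ} (hT : T.HasNoRotationUpTo N)
    (hy : y • T.parent c = T.parent c) (hyc : y • c ≠ c) {ι : Type*} {e : ι → ℤ}
    (he : Function.Injective e) (hN : ∀ i j, e i - e j ≤ N) :
    Function.Injective fun i => y ^ e i • c := by
  have hle {i j} (hij : y ^ e i • c = y ^ e j • c) : e i ≤ e j := by
    by_contra! hlt
    obtain ⟨n, hn⟩ := Int.eq_ofNat_of_zero_le (sub_nonneg.2 hlt.le)
    have hi := hN i j
    refine hyc (hT y c n (by omega) (by omega) hy ?_)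
    rw [← zpow_natCast, ← hn, sub_eq_neg_add, zpow_add, mul_smul, hij, ← mul_smul, ← zpow_add,
      neg_add_cancel, zpow_zero, one_smul]
  exact fun i j hij => he ((hle hij).antisymm (hle hij.symm))

theorem zpow_smul_eq (hy : y • v = v) (i : ℤ) : y ^ i • v = v :=
  MulAction.mem_stabilizer_iff.1 (zpow_mem (MulAction.mem_stabilizer_iff.2 hy) i)

theorem HasNoRotationUpTo.isFreeFamily {N : ℕ} (hT : T.HasNoRotationUpTo N)
    (hy : y • T.parent c = T.parent c) (hyc : y • c ≠ c) {ι : Type*} {g : ι → G} {e : ι → ℤ}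
    (hg : ∀ i, T.Enters (g i) (y ^ e i • c)) (he : Function.Injective e)
    (hN : ∀ i j, e i - e j ≤ N) : IsFreeFamily g :=
  isFreeFamily_of_enters hg (fun i => by rw [T.parent_smul, zpow_smul_eq hy])
    (hT.injective_zpow_smul hy hyc he hN)

/-- The axes of the hyperbolic elements `a` and `b` leave the same vertex, through its distinct
children `c` and `d`. -/
structure Forks (T : HoroTree G X) (a b : G) (c d : X) : Prop where
  enters_left : T.Enters a c
  enters_right : T.Enters b d
  parent_eq : T.parent c = T.parent d
  ne : c ≠ d

theorem Forks.symm (h : T.Forks a b c d) : T.Forks b a d c :=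
  ⟨h.enters_right, h.enters_left, h.parent_eq.symm, h.ne.symm⟩

/-- The axis of the hyperbolic element `a` passes from the parent of `c` to `c`, and `b` either
fixes that parent and moves `c`, or is hyperbolic with an axis that passes from that parent to
another child. -/
def Diverges (T : HoroTree G X) (a b : G) (c : X) : Prop :=
  (T.Enters a c ∧ b • T.parent c = T.parent c ∧ b • c ≠ c) ∨ ∃ d, T.Forks a b c d

theorem smul_mem_cone_iterate_parent (hx : g • x ∈ T.cone x) (j : ℕ) :
    g • T.parent^[j] x ∈ T.cone (T.parent^[j] x) := by
  obtain ⟨n, hn⟩ := hx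
  refine ⟨n, ?_⟩
  rw [← T.iterate_parent_smul, ← Function.iterate_add_apply, add_comm, Function.iterate_add_apply,
    hn]

theorem exists_smul_mem_cone [Nonempty X] (hg : 0 ≤ T.height g) : ∃ x, g • x ∈ T.cone x := by
  inhabit X
  obtain ⟨i, j, hij⟩ := T.exists_iterate_parent_eq (g • (default : X)) default
  have hlevel := congrArg T.level hij
  rw [T.level_iterate_parent, T.level_iterate_parent, T.level_smul] at hlevel
  refine ⟨T.parent^[j] default, i - j, ?_⟩
  rw [← T.iterate_parent_smul, ← Function.iterate_add_apply, show i - j + j = i by omega, hij]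

theorem exists_forall_smul_mem_cone [Nonempty X] {P : Set G} (hP : P.Finite)
    (hheight : ∀ g ∈ P, 0 ≤ T.height g) : ∃ x, ∀ g ∈ P, g • x ∈ T.cone x := by
  induction P, hP using Set.Finite.induction_on with
  | empty => exact ⟨Classical.arbitrary X, by simp⟩
  | @insert g P _ _ ih =>
    obtain ⟨x, hx⟩ := ih fun h hh => hheight h (Set.mem_insert_of_mem g hh)
    obtain ⟨y, hy⟩ := exists_smul_mem_cone (hheight g (Set.mem_insert g P))
    obtain ⟨i, j, hij⟩ := T.exists_iterate_parent_eq x y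
    refine ⟨T.parent^[i] x, fun h hh => ?_⟩
    rcases Set.mem_insert_iff.1 hh with rfl | hh
    · exact hij ▸ smul_mem_cone_iterate_parent hy j
    · exact smul_mem_cone_iterate_parent (hx h hh) i

theorem exists_enters (hg : 0 < T.height g) (hv : g • v ∈ T.cone v) :
    ∃ c, T.parent c = v ∧ T.Enters g c := by
  obtain ⟨_ | n, hn⟩ := hv
  · have hlevel := congrArg T.level hn
    rw [Function.iterate_zero_apply, T.level_smul] at hlevel
    omega
  · rw [Function.iterate_succ_apply'] at hn
    exact ⟨T.parent^[n] (g • v), hn, n, by rw [hn]⟩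

theorem smul_eq_of_mem_cone (hg : T.height g = 0) (hv : g • v ∈ T.cone v) : g • v = v := by
  obtain ⟨n, hn⟩ := hv
  have hlevel := congrArg T.level hn
  rw [T.level_iterate_parent, T.level_smul] at hlevel
  obtain rfl : n = 0 := by omega
  exact hn

theorem exists_child_forall_smul_mem_cone {P : Set G} (hheight : ∀ g ∈ P, 0 ≤ T.height g)
    (ha : a ∈ P) (hapos : 0 < T.height a) (hdiv : ∀ b ∈ P, ∀ c, ¬T.Diverges a b c)
    (hv : ∀ g ∈ P, g • v ∈ T.cone v) : ∃ c, T.parent c = v ∧ ∀ g ∈ P, g • c ∈ T.cone c := by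
  obtain ⟨c, rfl, hac⟩ := exists_enters hapos (hv a ha)
  refine ⟨c, rfl, fun g hg => ?_⟩
  have hgc := hdiv g hg c
  rcases (hheight g hg).eq_or_lt with hzero | hpos
  · have hfix : g • c = c := by
      by_contra hne
      exact hgc (.inl ⟨hac, smul_eq_of_mem_cone hzero.symm (hv g hg), hne⟩)
    exact hfix.symm ▸ self_mem_cone c
  · obtain ⟨d, hd, hgd⟩ := exists_enters hpos (hv g hg)
    obtain rfl : c = d := by
      by_contra hne
      exact hgc (.inr ⟨d, hac, hgd, hd.symm, hne⟩)
    exact hgd.mapsTo_cone (cone_subset_cone_parent c (self_mem_cone c))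

theorem exists_ray {p : X → Prop} (hv : p v) (hp : ∀ x, p x → ∃ c, T.parent c = x ∧ p c) :
    ∃ r : ℕ → X, (∀ j, p (r j)) ∧ ∀ j, T.parent (r (j + 1)) = r j := by
  choose! f hf hpf using hp
  have hr (j : ℕ) : p (f^[j] v) := by
    induction j with
    | zero => exact hv
    | succ j ih => exact Function.iterate_succ_apply' f j v ▸ hpf _ ih
  refine ⟨fun j => f^[j] v, hr, fun j => ?_⟩
  simp only [Function.iterate_succ_apply', hf _ (hr j)]

theorem iterate_parent_ray {r : ℕ → X} (hr : ∀ j, T.parent (r (j + 1)) = r j) (n j : ℕ) :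
    T.parent^[n] (r (j + n)) = r j := by
  induction n with
  | zero => rfl
  | succ n ih => rw [Function.iterate_succ_apply, ← add_assoc, hr, ih]

/-- The elements whose restriction to the ray `r` is eventually a shift of `r`, that is, the
stabilizer of the end to which `r` converges. -/
def raySubgroup (G : Type*) [Group G] [MulAction G X] (r : ℕ → X) : Subgroup G where
  carrier := {g | ∃ m n, ∀ j, g • r (j + m) = r (j + n)}
  one_mem' := ⟨0, 0, by simp⟩
  mul_mem' := by
    rintro g h ⟨m, n, hg⟩ ⟨m', n', hh⟩
    refine ⟨m + m', n + n', fun j => ?_⟩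
    rw [mul_smul, ← add_assoc, hh, add_right_comm, hg, add_right_comm, add_assoc]
  inv_mem' := by
    rintro g ⟨m, n, hg⟩
    exact ⟨n, m, fun j => by rw [inv_smul_eq_iff, hg]⟩

theorem mem_raySubgroup_of_smul_mem_cone {r : ℕ → X} (hr : ∀ j, T.parent (r (j + 1)) = r j)
    (hg : 0 ≤ T.height g) (hcone : ∀ j, g • r j ∈ T.cone (r j)) : g ∈ raySubgroup G r := by
  obtain ⟨n, hn⟩ := Int.eq_ofNat_of_zero_le hg
  refine ⟨0, n, fun j => ?_⟩
  obtain ⟨m, hm⟩ := hcone (j + n)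
  have hlevel := congrArg T.level hm
  rw [T.level_iterate_parent, T.level_smul] at hlevel
  rw [← hm, show m = n by omega, T.iterate_parent_smul, iterate_parent_ray hr, add_zero]

theorem smul_ray_zero_of_mem_raySubgroup {r : ℕ → X} (hr : ∀ j, T.parent (r (j + 1)) = r j)
    (hg : T.height g = 0) (hmem : g ∈ raySubgroup G r) : g • r 0 = r 0 := by
  obtain ⟨m, n, hmn⟩ := hmem
  have hlevel := congrArg T.level (hmn 0)
  rw [T.level_smul, hg, ← add_zero (T.level (r (0 + m)))] at hlevel
  have hray (i : ℕ) : T.level (r (0 + i)) = T.level (r 0) + i := by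
    rw [← iterate_parent_ray hr i 0, T.level_iterate_parent]
    omega
  rw [hray, hray] at hlevel
  obtain rfl : m = n := by omega
  rw [← iterate_parent_ray hr m 0, ← T.iterate_parent_smul, hmn]

theorem exists_finite_height_nonneg_closure_eq_top [Nonempty X] {S : Set G} (hfin : S.Finite)
    (hS : Subgroup.closure S = ⊤) :
    ∃ P : Set G, P.Finite ∧ Subgroup.closure P = ⊤ ∧ (∀ g ∈ P, 0 ≤ T.height g) ∧
      ∀ g ∈ P, g ∈ S ∨ g⁻¹ ∈ S := by
  refine ⟨{g | (g ∈ S ∨ g⁻¹ ∈ S) ∧ 0 ≤ T.height g},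
    (hfin.union hfin.inv).subset fun g hg => hg.1, ?_, fun g hg => hg.2, fun g hg => hg.1⟩
  rw [eq_top_iff, ← hS, Subgroup.closure_le]
  intro s hs
  rcases le_total 0 (T.height s) with hpos | hneg
  · exact Subgroup.subset_closure ⟨.inl hs, hpos⟩
  · refine inv_mem_iff.1 (Subgroup.subset_closure ⟨.inr (by rwa [inv_inv]), ?_⟩)
    rw [T.height_inv (Classical.arbitrary X)]
    omega

/-- If no pair of generators diverged, a ray of vertices whose cones are respected by all the
generators of nonnegative height could be built by descending along the axis of one of them. The
whole group would then stabilize the end of this ray, so that its elements of height zero would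
fix the origin of the ray. -/
theorem exists_diverges [Nonempty X] {S : Set G} (hfin : S.Finite)
    (hS : Subgroup.closure S = ⊤) (hmove : ∀ x : X, ∃ g, T.height g = 0 ∧ g • x ≠ x) :
    ∃ a b c, (a ∈ S ∨ a⁻¹ ∈ S) ∧ (b ∈ S ∨ b⁻¹ ∈ S) ∧ T.Diverges a b c := by
  obtain ⟨P, hPfin, hP, hheight, hPS⟩ := exists_finite_height_nonneg_closure_eq_top (T := T) hfin hS
  have hle {K : Subgroup G} (hK : P ⊆ K) (g : G) : g ∈ K := by
    have hKtop : K = ⊤ := top_le_iff.1 (hP ▸ (Subgroup.closure_le K).2 hK)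
    exact hKtop ▸ Subgroup.mem_top g
  obtain ⟨v, hv⟩ := exists_forall_smul_mem_cone hPfin hheight
  obtain ⟨a, ha, hapos⟩ : ∃ a ∈ P, 0 < T.height a := by
    by_contra! hnonpos
    obtain ⟨g, -, hg⟩ := hmove v
    exact hg <| hle (K := MulAction.stabilizer G v) (fun h hh =>
      smul_eq_of_mem_cone ((hnonpos h hh).antisymm (hheight h hh)) (hv h hh)) g
  by_contra! hno
  obtain ⟨r, hcone, hr⟩ := exists_ray (T := T) hv fun x hx =>
    exists_child_forall_smul_mem_cone hheight ha hapos
      (fun b hb c => hno a b c (hPS a ha) (hPS b hb)) hx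
  obtain ⟨g, hg, hgr⟩ := hmove (r 0)
  exact hgr <| smul_ray_zero_of_mem_raySubgroup hr hg <|
    hle (fun h hh => mem_raySubgroup_of_smul_mem_cone hr (hheight h hh) fun j => hcone j h hh) g

end HoroTree

section AscendingHNN

open HNNExtension

variable {H : Type*} [Group H] {B : Subgroup H} {θ : (⊤ : Subgroup H) ≃* B}

theorem t_mul_of_mul_t_inv (h : H) :
    (t * of h * t⁻¹ : HNNExtension H ⊤ B θ) = of (θ ⟨h, Subgroup.mem_top h⟩ : H) :=
  (equiv_eq_conj ⟨h, Subgroup.mem_top h⟩).symm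

/-- The vertices of the Bass–Serre tree of the ascending HNN extension: the cosets of its base. -/
abbrev HNNVertex (B : Subgroup H) (θ : (⊤ : Subgroup H) ≃* B) : Type _ :=
  HNNExtension H ⊤ B θ ⧸ (of : H →* HNNExtension H ⊤ B θ).range

theorem smul_base_eq_iff {g : HNNExtension H ⊤ B θ} :
    g • ((1 : HNNExtension H ⊤ B θ) : HNNVertex B θ) = (1 : HNNExtension H ⊤ B θ) ↔
      ∃ h, of h = g := by
  rw [← MulAction.mem_stabilizer_iff, MulAction.stabilizer_quotient, MonoidHom.mem_range]

theorem exists_smul_base_eq (x : HNNVertex B θ) :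
    ∃ g : HNNExtension H ⊤ B θ, g • ((1 : HNNExtension H ⊤ B θ) : HNNVertex B θ) = x := by
  obtain ⟨g, rfl⟩ := QuotientGroup.mk_surjective x
  exact ⟨g, by rw [MulAction.Quotient.smul_coe, smul_eq_mul, mul_one]⟩

theorem exists_smul_t_eq (x : HNNVertex B θ) :
    ∃ g : HNNExtension H ⊤ B θ, g • ((t : HNNExtension H ⊤ B θ) : HNNVertex B θ) = x := by
  obtain ⟨g, rfl⟩ := QuotientGroup.mk_surjective x
  exact ⟨g * t⁻¹, by rw [MulAction.Quotient.smul_coe, smul_eq_mul, inv_mul_cancel_right]⟩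

theorem of_smul_t_eq_iff {h : H} :
    (of h : HNNExtension H ⊤ B θ) • ((t : HNNExtension H ⊤ B θ) : HNNVertex B θ) =
      (t : HNNExtension H ⊤ B θ) ↔ h ∈ B := by
  rw [MulAction.Quotient.smul_coe, smul_eq_mul, eq_comm, QuotientGroup.eq, MonoidHom.mem_range]
  constructor
  · rintro ⟨h', hh'⟩
    have hconj : of (θ ⟨h', Subgroup.mem_top h'⟩ : H) = (of h : HNNExtension H ⊤ B θ) := by
      rw [← t_mul_of_mul_t_inv, hh']
      group
    exact of_injective θ hconj ▸ SetLike.coe_mem _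
  · intro hh
    exact ⟨θ.symm ⟨h, hh⟩, by rw [equiv_symm_eq_conj, mul_assoc]⟩

/-- The vertex `g H` is joined to `g t⁻¹ H`, which depends only on the coset as `t H t⁻¹ ≤ H`. -/
def hnnParent (x : HNNVertex B θ) : HNNVertex B θ :=
  Quotient.map' (· * t⁻¹) (fun g g' hg => by
    rw [QuotientGroup.leftRel_apply, MonoidHom.mem_range] at hg ⊢
    obtain ⟨h, hh⟩ := hg
    refine ⟨θ ⟨h, Subgroup.mem_top h⟩, ?_⟩
    rw [← t_mul_of_mul_t_inv, hh]
    group) x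

theorem hnnParent_mk (g : HNNExtension H ⊤ B θ) :
    hnnParent (g : HNNVertex B θ) = ((g * t⁻¹ : HNNExtension H ⊤ B θ) : HNNVertex B θ) :=
  rfl

theorem hnnParent_smul (g : HNNExtension H ⊤ B θ) (x : HNNVertex B θ) :
    hnnParent (g • x) = g • hnnParent x := by
  obtain ⟨u, rfl⟩ := QuotientGroup.mk_surjective x
  simp only [hnnParent_mk, MulAction.Quotient.smul_coe, smul_eq_mul, mul_assoc]

theorem hnnParent_t :
    hnnParent ((t : HNNExtension H ⊤ B θ) : HNNVertex B θ) = (1 : HNNExtension H ⊤ B θ) := by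
  rw [hnnParent_mk, mul_inv_cancel]

theorem exists_iterate_hnnParent_smul_base_eq (g : HNNExtension H ⊤ B θ) :
    ∃ i j, hnnParent^[i] (g • ((1 : HNNExtension H ⊤ B θ) : HNNVertex B θ)) =
      hnnParent^[j] ((1 : HNNExtension H ⊤ B θ) : HNNVertex B θ) := by
  have hsmul := iterate_smul_of_equivariant (hnnParent_smul (B := B) (θ := θ))
  induction g using HNNExtension.induction_on with
  | of h => exact ⟨0, 0, smul_base_eq_iff.2 ⟨h, rfl⟩⟩
  | t => exact ⟨1, 0, by simpa using hnnParent_t⟩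
  | mul g g' hg hg' =>
    obtain ⟨i, j, hij⟩ := hg
    obtain ⟨i', j', hij'⟩ := hg'
    refine ⟨i + i', j' + j, ?_⟩
    rw [mul_smul, Function.iterate_add_apply, hsmul, hij', ← hsmul, ← Function.iterate_add_apply,
      add_comm, Function.iterate_add_apply, hij, ← Function.iterate_add_apply]
  | inv g hg =>
    obtain ⟨i, j, hij⟩ := hg
    exact ⟨j, i, by rw [hsmul, inv_smul_eq_iff, ← hij, hsmul]⟩

theorem exists_iterate_hnnParent_eq (x y : HNNVertex B θ) :
    ∃ i j, hnnParent^[i] x = hnnParent^[j] y := by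
  obtain ⟨g, rfl⟩ := exists_smul_base_eq x
  obtain ⟨g', rfl⟩ := exists_smul_base_eq y
  obtain ⟨i, j, hij⟩ := exists_iterate_hnnParent_smul_base_eq g
  obtain ⟨i', j', hij'⟩ := exists_iterate_hnnParent_smul_base_eq g'
  refine ⟨j' + i, j + i', ?_⟩
  rw [Function.iterate_add_apply, hij, Function.iterate_add_apply, hij',
    ← Function.iterate_add_apply, ← Function.iterate_add_apply, add_comm]

/-- The exponent sum of the stable letter. -/
def tExponent : HNNExtension H ⊤ B θ →* Multiplicative ℤ :=
  lift 1 (Multiplicative.ofAdd 1) (by simp)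

/-- The Bass–Serre tree of an ascending HNN extension, with the end it fixes. -/
def hnnTree (B : Subgroup H) (θ : (⊤ : Subgroup H) ≃* B) :
    HoroTree (HNNExtension H ⊤ B θ) (HNNVertex B θ) where
  parent := hnnParent
  level x := (Quotient.lift tExponent (fun g g' hg => by
    obtain ⟨h, hh⟩ := QuotientGroup.leftRel_apply.1 hg
    rw [← inv_mul_eq_one, ← map_inv, ← map_mul, ← hh, tExponent, lift_of, MonoidHom.one_apply])
    x).toAdd
  height g := (tExponent g).toAdd
  parent_smul := hnnParent_smul
  level_parent x := by
    obtain ⟨g, rfl⟩ := QuotientGroup.mk_surjective x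
    change (tExponent (g * t⁻¹)).toAdd = (tExponent g).toAdd - 1
    rw [map_mul, map_inv, tExponent, lift_t]
    rfl
  level_smul g x := by
    obtain ⟨u, rfl⟩ := QuotientGroup.mk_surjective x
    change (tExponent (g * u)).toAdd = (tExponent u).toAdd + (tExponent g).toAdd
    rw [map_mul, toAdd_mul, add_comm]
  exists_iterate_parent_eq := exists_iterate_hnnParent_eq

theorem exists_height_eq_zero_smul_ne (hB : B ≠ ⊤) (x : HNNVertex B θ) :
    ∃ g, (hnnTree B θ).height g = 0 ∧ g • x ≠ x := by
  obtain ⟨h, hh⟩ := SetLike.exists_not_mem_of_ne_top B hB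
  obtain ⟨u, rfl⟩ := exists_smul_t_eq x
  refine ⟨u * of h * u⁻¹, ?_, ?_⟩
  · change (tExponent _).toAdd = 0
    simp [tExponent]
  · rw [mul_smul, inv_smul_smul, mul_smul]
    exact fun hfix => hh (of_smul_t_eq_iff.1 (MulAction.injective u hfix))

/-- The subgroup `B` is isolated with respect to exponents up to `N`: an element with a power of
exponent `1, …, N` in `B` lies in `B`. -/
def IsIsolatedUpTo (B : Subgroup H) (N : ℕ) : Prop :=
  ∀ (h : H) (i : ℕ), 0 < i → i ≤ N → h ^ i ∈ B → h ∈ B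

theorem IsIsolatedUpTo.hasNoRotationUpTo {N : ℕ} (hB : IsIsolatedUpTo B N)
    (θ : (⊤ : Subgroup H) ≃* B) : (hnnTree B θ).HasNoRotationUpTo N := by
  intro g x i hi hiN hparent hpow
  obtain ⟨u, rfl⟩ := exists_smul_t_eq x
  obtain ⟨h, hh⟩ : ∃ h, of h = u⁻¹ * g * u := by
    rw [← smul_base_eq_iff, mul_smul, mul_smul, inv_smul_eq_iff, ← hnnParent_t, ← hnnParent_smul]
    exact hparent
  obtain rfl : g = u * of h * u⁻¹ := by rw [hh]; group
  rw [conj_pow, mul_smul, inv_smul_smul, mul_smul, ← map_pow] at hpow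
  rw [mul_smul, inv_smul_smul, mul_smul,
    of_smul_t_eq_iff.2 (hB h i hi hiN (of_smul_t_eq_iff.1 (MulAction.injective u hpow)))]

theorem ne_top_of_index_eq_prime {p : ℕ} (hp : p.Prime) (hB : B.index = p) : B ≠ ⊤ := by
  rintro rfl
  exact hp.one_lt.ne (Subgroup.index_top.symm.trans hB)

theorem isIsolatedUpTo_of_index_eq_prime [B.Normal] {p N : ℕ} (hp : p.Prime) (hB : B.index = p)
    (hN : N < p) : IsIsolatedUpTo B N := by
  intro h i hi hiN hpow
  have hcop : i.Coprime p := (Nat.coprime_of_lt_prime hi.ne' (hiN.trans_lt hN) hp).symm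
  have hindex : h ^ p ∈ B := hB ▸ B.pow_index_mem h
  rw [← QuotientGroup.eq_one_iff, QuotientGroup.mk_pow] at hpow hindex
  rw [← QuotientGroup.eq_one_iff, ← pow_one (h : H ⧸ B), ← hcop.gcd_eq_one]
  exact pow_gcd_eq_one.2 ⟨hpow, hindex⟩

end AscendingHNN

section LowerBounds

variable {G X : Type*} [Group G] [MulAction G X] {T : HoroTree G X} {S : Set G} {a b g y : G}
  {c d : X} {k : ℕ}

theorem wordLength_le_one (hg : g ∈ S ∨ g⁻¹ ∈ S) : wordLength S g ≤ 1 := by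
  simpa using wordLength_prod_le_length (l := [g]) (by simpa [IsWord] using hg)

theorem wordLength_pow_mul_le (hS : Subgroup.closure S = ⊤) (g h : G) (n : ℕ) :
    wordLength S (g ^ n * h) ≤ n * wordLength S g + wordLength S h := by
  induction n with
  | zero => simp
  | succ n ih =>
    rw [pow_succ', mul_assoc]
    linarith [wordLength_mul_le hS g (g ^ n * h)]

namespace HoroTree

theorem Diverges.goldenRatio_le_growthRate (h : T.Diverges a b c) (hfin : S.Finite)
    (hS : Subgroup.closure S = ⊤) (ha : a ∈ S ∨ a⁻¹ ∈ S) (hb : b ∈ S ∨ b⁻¹ ∈ S) :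
    Real.goldenRatio ≤ growthRate S := by
  obtain ⟨d, hdc, hd, hba⟩ : ∃ d ≠ c, T.parent d = T.parent c ∧ T.Enters (b * a) d := by
    obtain ⟨hac, hbv, hbc⟩ | ⟨d, h⟩ := h
    · exact ⟨b • c, hbc, by rw [T.parent_smul, hbv], hac.fixes_mul hbv⟩
    · exact ⟨d, h.ne.symm, h.parent_eq.symm, h.enters_right.mul h.enters_left h.parent_eq⟩
  have hac : T.Enters a c := Or.elim h And.left fun ⟨_, h⟩ => h.enters_left
  have hfree : IsFreeFamily ![a, b * a] :=
    isFreeFamily_of_enters (T := T) (c := ![c, d]) (v := T.parent c)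
      (Fin.forall_fin_two.2 ⟨hac, hba⟩) (Fin.forall_fin_two.2 ⟨rfl, hd⟩)
      (by simp [Function.Injective, Fin.forall_fin_two, hdc, hdc.symm])
  have hlength : ∀ i, wordLength S (![a, b * a] i) ≤ ![1, 2] i :=
    Fin.forall_fin_two.2 ⟨wordLength_le_one ha, (wordLength_mul_le hS b a).trans
      (add_le_add (wordLength_le_one hb) (wordLength_le_one ha))⟩
  have hsum : Real.goldenRatio⁻¹ + Real.goldenRatio⁻¹ ^ 2 = 1 := by
    rw [Real.inv_goldenRatio]
    linear_combination Real.goldenConj_sq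
  rw [← inv_inv Real.goldenRatio, ← one_div]
  exact one_div_le_growthRate hfin hS hfree hlength (inv_pos.2 Real.goldenRatio_pos)
    (inv_le_one_of_one_le₀ Real.one_lt_goldenRatio.le)
    (by simp only [Fin.sum_univ_two, Matrix.cons_val_zero, Matrix.cons_val_one, pow_one, hsum,
      le_refl])

theorem Forks.two_le_growthRate (h : T.Forks a b c d) (hfin : S.Finite)
    (hS : Subgroup.closure S = ⊤) (ha : a ∈ S ∨ a⁻¹ ∈ S) (hb : b ∈ S ∨ b⁻¹ ∈ S) :
    2 ≤ growthRate S := by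
  have hfree : IsFreeFamily ![a, b] :=
    isFreeFamily_of_enters (T := T) (c := ![c, d]) (v := T.parent d)
      (Fin.forall_fin_two.2 ⟨h.enters_left, h.enters_right⟩)
      (Fin.forall_fin_two.2 ⟨h.parent_eq, rfl⟩)
      (by simp [Function.Injective, Fin.forall_fin_two, h.ne, h.ne.symm])
  simpa using one_div_le_growthRate hfin hS hfree (n := fun _ => 1) (z := 1 / 2)
    (Fin.forall_fin_two.2 ⟨wordLength_le_one ha, wordLength_le_one hb⟩) (by norm_num)
    (by norm_num) (by norm_num)

/-- The exponents `0, ±1, …, ±k`. -/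
def signedExponent (k : ℕ) : Option (Fin k ⊕ Fin k) → ℤ
  | none => 0
  | some (.inl i) => i + 1
  | some (.inr i) => -(i + 1)

theorem signedExponent_injective (k : ℕ) : Function.Injective (signedExponent k) := by
  rintro (_ | i | i) (_ | j | j) hij <;>
    simp only [signedExponent, Option.some.injEq, Sum.inl.injEq, Sum.inr.injEq, Fin.ext_iff,
      reduceCtorEq] at hij ⊢ <;> omega

theorem signedExponent_sub_le (k : ℕ) (i j : Option (Fin k ⊕ Fin k)) :
    signedExponent k i - signedExponent k j ≤ (2 * k : ℕ) := by
  rcases i with _ | i | i <;> rcases j with _ | j | j <;> simp only [signedExponent] <;> omega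

theorem HasNoRotationUpTo.one_div_le_growthRate (hT : T.HasNoRotationUpTo (2 * k))
    (hfin : S.Finite) (hS : Subgroup.closure S = ⊤) (ha : T.Enters a c)
    (hy : y • T.parent c = T.parent c) (hyc : y • c ≠ c) {m : ℕ} {n n' : ℕ → ℕ}
    (hm : wordLength S a ≤ m) (hn : ∀ i, wordLength S (y ^ (i + 1) * a) ≤ n i)
    (hn' : ∀ i, wordLength S (y⁻¹ ^ (i + 1) * a) ≤ n' i) {z : ℝ} (hz : 0 < z) (hz1 : z ≤ 1)
    (hsum : 1 ≤ z ^ m + (∑ i ∈ Finset.range k, z ^ n i + ∑ i ∈ Finset.range k, z ^ n' i)) :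
    1 / z ≤ growthRate S := by
  have hfree : IsFreeFamily fun i => y ^ signedExponent k i * a :=
    hT.isFreeFamily hy hyc (fun i => ha.fixes_mul (zpow_smul_eq hy _))
      (signedExponent_injective k) (signedExponent_sub_le k)
  refine GroupGrowth.one_div_le_growthRate hfin hS hfree
    (n := fun i => i.elim m (Sum.elim (fun j => n j) fun j => n' j)) ?_ hz hz1 ?_
  · rintro (_ | i | i)
    · simpa [signedExponent] using hm
    · simpa [signedExponent] using mod_cast hn i
    · simpa only [signedExponent, ← inv_zpow'] using mod_cast hn' i
  · simpa [Fintype.sum_option, Fintype.sum_sum_type, Finset.sum_range] using hsum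

theorem HasNoRotationUpTo.omegaRoot_le_growthRate_of_fixes (hT : T.HasNoRotationUpTo (2 * k))
    (hk : 0 < k) (hfin : S.Finite) (hS : Subgroup.closure S = ⊤) (ha : a ∈ S ∨ a⁻¹ ∈ S)
    (hb : b ∈ S ∨ b⁻¹ ∈ S) (hac : T.Enters a c) (hbv : b • T.parent c = T.parent c)
    (hbc : b • c ≠ c) : omegaRoot k ≤ growthRate S := by
  have hlength {g : G} (hg : g ∈ S ∨ g⁻¹ ∈ S) (i : ℕ) :
      wordLength S (g ^ (i + 1) * a) ≤ i + 2 := by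
    linarith [wordLength_pow_mul_le hS g a (i + 1), wordLength_le_one ha,
      Nat.mul_le_mul_left (i + 1) (wordLength_le_one hg)]
  have hsum := inv_omegaRoot_add_sum hk
  simpa using hT.one_div_le_growthRate hfin hS hac hbv hbc (wordLength_le_one ha) (hlength hb)
    (hlength (by rw [inv_inv]; exact hb.symm)) (inv_pos.2 (omegaRoot_pos k))
    (inv_le_one_of_one_le₀ (one_lt_omegaRoot hk).le) (by linarith)

theorem Forks.omegaRoot_le_growthRate_of_height_eq (h : T.Forks a b c d)
    (hheight : T.height a = T.height b) (hk : 0 < k) (hT : T.HasNoRotationUpTo (2 * k))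
    (hfin : S.Finite) (hS : Subgroup.closure S = ⊤) (ha : a ∈ S ∨ a⁻¹ ∈ S)
    (hb : b ∈ S ∨ b⁻¹ ∈ S) : omegaRoot k ≤ growthRate S := by
  have hyc : (b * a⁻¹) • c = d := h.enters_right.mul_inv_smul_eq h.enters_left h.parent_eq hheight
  have hlength {g h h' : G} (hg : g ∈ S ∨ g⁻¹ ∈ S) (hh : h ∈ S ∨ h⁻¹ ∈ S)
      (hh' : h' ∈ S ∨ h'⁻¹ ∈ S) (i : ℕ) : wordLength S ((g * h) ^ i * h') ≤ 2 * i + 1 := by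
    have hgh : wordLength S (g * h) ≤ 2 := (wordLength_mul_le hS g h).trans
      (add_le_add (wordLength_le_one hg) (wordLength_le_one hh))
    linarith [wordLength_pow_mul_le hS (g * h) h' i, wordLength_le_one hh',
      Nat.mul_le_mul_left i hgh]
  have ha' : a⁻¹ ∈ S ∨ a⁻¹⁻¹ ∈ S := by rw [inv_inv]; exact ha.symm
  have hb' : b⁻¹ ∈ S ∨ b⁻¹⁻¹ ∈ S := by rw [inv_inv]; exact hb.symm
  rw [← inv_inv (omegaRoot k), ← one_div]
  refine hT.one_div_le_growthRate hfin hS h.enters_left (parent_eq_of_smul_eq hyc h.parent_eq)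
    (hyc ▸ h.ne.symm) (m := 1) (n := fun i => 2 * i + 1) (n' := fun i => 2 * i + 3)
    (wordLength_le_one ha) (fun i => ?_) (fun i => ?_) (inv_pos.2 (omegaRoot_pos k))
    (inv_le_one_of_one_le₀ (one_lt_omegaRoot hk).le) ?_
  · rw [pow_succ, mul_assoc, inv_mul_cancel_right]
    exact hlength hb ha' hb i
  · rw [mul_inv_rev, inv_inv]
    exact hlength ha hb' ha (i + 1)
  · simpa using one_le_inv_omegaRoot_add_sum_odd hk

theorem HasNoRotationUpTo.isFreeFamily_four {N : ℕ} (hT : T.HasNoRotationUpTo N) (hN : 3 ≤ N)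
    (hy : y • T.parent c = T.parent c) (hyc : y • c ≠ c) (ha : T.Enters a c)
    (hb : T.Enters b (y • c)) : IsFreeFamily ![a, y⁻¹ * a, b, y * b] := by
  refine hT.isFreeFamily hy hyc (e := ![0, -1, 1, 2]) ?_ (by decide) fun i j => ?_
  · have ha' := ha.fixes_mul (inv_smul_eq_iff.2 hy.symm)
    have hb' := hb.fixes_mul (y := y) (by rw [T.parent_smul, hy, hy])
    simp [Fin.forall_fin_succ, ha, hb, ha', zpow_ofNat, pow_two, mul_smul, hb']
  · fin_cases i <;> fin_cases j <;> simp <;> omega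

theorem HasNoRotationUpTo.one_div_le_growthRate_of_prefixCode {N : ℕ}
    (hT : T.HasNoRotationUpTo N) (hN : 3 ≤ N) (hfin : S.Finite) (hS : Subgroup.closure S = ⊤)
    {α κ : Type*} [DecidableEq α] [Fintype κ] {f : α → G} (hf : ∀ i, f i ∈ S ∨ (f i)⁻¹ ∈ S)
    {x x' y : FreeGroup α} (hy : FreeGroup.lift f y • c = d) (hcd : T.parent c = T.parent d)
    (hne : c ≠ d) (hx : T.Enters (FreeGroup.lift f x) c) (hx' : T.Enters (FreeGroup.lift f x') d)
    {w : κ → List (Fin 4)} (hw : IsPrefixCode w) (v : FreeGroup α) {n : κ → ℕ}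
    (hn : ∀ i, (v * ((w i).map ![x, y⁻¹ * x, x', y * x']).prod * v⁻¹).norm ≤ n i) {z : ℝ}
    (hz : 0 < z) (hz1 : z ≤ 1) (hsum : 1 ≤ ∑ i, z ^ n i) : 1 / z ≤ growthRate S := by
  refine GroupGrowth.one_div_le_growthRate_of_prefixCode hfin hS hf ?_ hw v hn hz hz1 hsum
  have hfree := hT.isFreeFamily_four hN (parent_eq_of_smul_eq hy hcd) (hy ▸ hne.symm) hx
    (hy.symm ▸ hx')
  convert hfree using 1
  funext i
  fin_cases i <;> simp

end HoroTree

end LowerBounds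

section UnequalHeights

variable {G X : Type*} [Group G] [MulAction G X] {T : HoroTree G X} {S : Set G} {a b : G}
  {c d : X} {k N : ℕ}

local notation "α" => FreeGroup.of (0 : Fin 2)
local notation "β" => FreeGroup.of (1 : Fin 2)

theorem forall_mem_or_inv_mem_pair (ha : a ∈ S ∨ a⁻¹ ∈ S) (hb : b ∈ S ∨ b⁻¹ ∈ S) :
    ∀ i, ![a, b] i ∈ S ∨ (![a, b] i)⁻¹ ∈ S :=
  Fin.forall_fin_two.2 ⟨ha, hb⟩

namespace HoroTree

-- Conjugation by `v` shortens the code words. The codes, here and below, were found by searching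
-- for words whose lengths `n` after this conjugation satisfy `1 ≤ ∑ (12 / 29) ^ n`.
theorem Forks.le_growthRate_of_height_lt_two_mul (h : T.Forks a b c d)
    (hlt : T.height a < T.height b) (hlt' : T.height b < 2 * T.height a)
    (hT : T.HasNoRotationUpTo N) (hN : 3 ≤ N)
    (hfin : S.Finite) (hS : Subgroup.closure S = ⊤) (ha : a ∈ S ∨ a⁻¹ ∈ S)
    (hb : b ∈ S ∨ b⁻¹ ∈ S) : 29 / 12 ≤ growthRate S := by
  obtain ⟨hac, hbd, hcd, hne⟩ := h
  have hbad : T.Enters (b * a⁻¹) d := hbd.mul_inv hac hcd hlt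
  have hheight : T.height (b * a⁻¹) < T.height a := by
    rw [T.height_mul c, T.height_inv c]
    linarith
  have haba : T.Enters (a * (b * a⁻¹)⁻¹) c := hac.mul_inv hbad hcd.symm hheight
  have hrate := hT.one_div_le_growthRate_of_prefixCode hN hfin hS (forall_mem_or_inv_mem_pair ha hb)
    (y := β * α * β⁻¹ * α⁻¹) (x := α * (β * α⁻¹)⁻¹) (x' := β * α⁻¹)
    (by simpa using hbd.commutator_smul_eq hac hcd) hcd hne (by simpa using haba)
    (by simpa using hbad)
    (w := ![[0], [2, 0], [2, 1], [2, 2, 0], [2, 2, 1], [2, 2, 2, 0], [2, 2, 2, 2, 0],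
      [2, 2, 2, 2, 1]])
    ⟨by decide, by decide⟩ (α * β⁻¹) (n := ![3, 1, 5, 1, 5, 3, 5, 9]) (by decide +kernel)
    (z := 12 / 29) (by norm_num) (by norm_num) (by norm_num [Fin.sum_univ_succ])
  simpa using hrate

theorem Forks.le_growthRate_of_height_eq_two_mul (h : T.Forks a b c d)
    (heq : T.height b = 2 * T.height a) (hT : T.HasNoRotationUpTo N) (hN : 3 ≤ N)
    (hfin : S.Finite) (hS : Subgroup.closure S = ⊤) (ha : a ∈ S ∨ a⁻¹ ∈ S)
    (hb : b ∈ S ∨ b⁻¹ ∈ S) : 29 / 12 ≤ growthRate S := by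
  obtain ⟨hac, hbd, hcd, hne⟩ := h
  have hpos := hac.height_pos
  have hheight : T.height (a * a) = T.height b := by
    rw [T.height_mul c, heq, two_mul]
  have hrate := hT.one_div_le_growthRate_of_prefixCode hN hfin hS (forall_mem_or_inv_mem_pair ha hb)
    (y := β * (α * α)⁻¹) (x := α) (x' := β * α⁻¹)
    (by simpa using hbd.mul_inv_smul_eq (hac.mul hac rfl) hcd hheight) hcd hne (by simpa using hac)
    (by simpa using hbd.mul_inv hac hcd (by linarith))
    (w := ![[0], [1], [2, 0], [2, 1], [2, 2, 0], [2, 2, 2, 0], [2, 2, 2, 2], [3, 0], [3, 2]])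
    ⟨by decide, by decide⟩ 1 (n := ![1, 4, 1, 4, 3, 5, 8, 4, 7]) (by decide +kernel)
    (z := 12 / 29) (by norm_num) (by norm_num) (by norm_num [Fin.sum_univ_succ])
  simpa using hrate

/-- The prefix code for a fork with `2 * height a < height b`, in the letters `0, 1, 2, 3` for
`x = a`, `y⁻¹ x`, `x' = b a⁻²`, `y x'`, where `y` is a commutator. Conjugated by `a⁻²`, the word
`0ⁱ 2` becomes `aⁱ⁻² b`; with all exponents `j ∈ ℤ` the elements `aʲ b` alone would give the rate
`1 + √2`, and the other words compensate for the missing exponents. -/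
def forkCode : Fin 7 ⊕ Fin 5 ⊕ Fin 4 × Fin 3 → List (Fin 4)
  | .inl i => List.replicate i 0 ++ [2]
  | .inr (.inl i) => List.replicate i 0 ++ [3]
  | .inr (.inr (i, j)) => List.replicate i 0 ++ [1] ++ List.replicate j 0 ++ [2]

theorem isPrefixCode_forkCode : IsPrefixCode forkCode :=
  ⟨by decide +kernel, by decide +kernel⟩

theorem Forks.le_growthRate_of_two_mul_lt_height (h : T.Forks a b c d)
    (hlt : 2 * T.height a < T.height b) (hT : T.HasNoRotationUpTo N) (hN : 3 ≤ N)
    (hfin : S.Finite) (hS : Subgroup.closure S = ⊤) (ha : a ∈ S ∨ a⁻¹ ∈ S)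
    (hb : b ∈ S ∨ b⁻¹ ∈ S) : 29 / 12 ≤ growthRate S := by
  obtain ⟨hac, hbd, hcd, hne⟩ := h
  have hheight : T.height (a * a) < T.height b := by
    rwa [T.height_mul c, ← two_mul]
  have hrate := hT.one_div_le_growthRate_of_prefixCode hN hfin hS (forall_mem_or_inv_mem_pair ha hb)
    (y := β * α * β⁻¹ * α⁻¹) (x := α) (x' := β * (α * α)⁻¹)
    (by simpa using hbd.commutator_smul_eq hac hcd) hcd hne (by simpa using hac)
    (by simpa using hbd.mul_inv (hac.mul hac rfl) hcd hheight)
    isPrefixCode_forkCode (α⁻¹ * α⁻¹)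
    (n := Sum.elim (fun i => Nat.dist i 2 + 1) (Sum.elim (fun i => Nat.dist i 2 + 5)
      fun i => Nat.dist i.1 1 + i.2 + 5))
    (by decide +kernel) (z := 12 / 29) (by norm_num) (by norm_num)
    (by norm_num [Fintype.sum_sum_type, Fintype.sum_prod_type, Fin.sum_univ_succ, Nat.dist])
  simpa using hrate

theorem Forks.le_growthRate_of_height_lt (h : T.Forks a b c d)
    (hlt : T.height a < T.height b) (hT : T.HasNoRotationUpTo N) (hN : 3 ≤ N)
    (hfin : S.Finite) (hS : Subgroup.closure S = ⊤) (ha : a ∈ S ∨ a⁻¹ ∈ S)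
    (hb : b ∈ S ∨ b⁻¹ ∈ S) : 29 / 12 ≤ growthRate S := by
  rcases lt_trichotomy (T.height b) (2 * T.height a) with hlt' | heq | hgt
  · exact h.le_growthRate_of_height_lt_two_mul hlt hlt' hT hN hfin hS ha hb
  · exact h.le_growthRate_of_height_eq_two_mul heq hT hN hfin hS ha hb
  · exact h.le_growthRate_of_two_mul_lt_height hgt hT hN hfin hS ha hb

theorem Diverges.omegaRoot_le_growthRate (h : T.Diverges a b c) (hk : 0 < k)
    (hT : T.HasNoRotationUpTo (2 * k)) (hfin : S.Finite) (hS : Subgroup.closure S = ⊤)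
    (ha : a ∈ S ∨ a⁻¹ ∈ S) (hb : b ∈ S ∨ b⁻¹ ∈ S) : omegaRoot k ≤ growthRate S := by
  obtain ⟨hac, hbv, hbc⟩ | ⟨d, h⟩ := h
  · exact hT.omegaRoot_le_growthRate_of_fixes hk hfin hS ha hb hac hbv hbc
  obtain rfl | hk1 := (Nat.succ_le_of_lt hk).eq_or_lt
  · exact omegaRoot_one.trans_le (h.two_le_growthRate hfin hS ha hb)
  have hN : 3 ≤ 2 * k := by omega
  rcases lt_trichotomy (T.height a) (T.height b) with hlt | heq | hgt
  · exact (omegaRoot_le k).trans (h.le_growthRate_of_height_lt hlt hT hN hfin hS ha hb)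
  · exact h.omegaRoot_le_growthRate_of_height_eq heq hk hT hfin hS ha hb
  · exact (omegaRoot_le k).trans (h.symm.le_growthRate_of_height_lt hgt hT hN hfin hS hb ha)

end HoroTree

end UnequalHeights

end GroupGrowth

open GroupGrowth in
theorem theorem2_general {H : Type*} [Group H] (B : Subgroup H) (hB : B ≠ ⊤)
    (θ : (⊤ : Subgroup H) ≃* B) [Group.FG (HNNExtension H ⊤ B θ)] :
    (1 + Real.sqrt 5) / 2 ≤ minGrowthRate (HNNExtension H ⊤ B θ) ∧
    ∀ k, 0 < k → IsIsolatedUpTo B (2 * k) →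
      omegaRoot k ≤ minGrowthRate (HNNExtension H ⊤ B θ) := by
  have hdiv {S : Set (HNNExtension H ⊤ B θ)} (hfin : S.Finite) (hS : Subgroup.closure S = ⊤) :=
    HoroTree.exists_diverges (T := hnnTree B θ) hfin hS (exists_height_eq_zero_smul_ne hB)
  refine ⟨le_minGrowthRate fun S hfin hS => ?_, fun k hk hisol =>
    le_minGrowthRate fun S hfin hS => ?_⟩
  · obtain ⟨a, b, c, ha, hb, h⟩ := hdiv hfin hS
    exact h.goldenRatio_le_growthRate hfin hS ha hb
  · obtain ⟨a, b, c, ha, hb, h⟩ := hdiv hfin hS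
    exact h.omegaRoot_le_growthRate hk (hisol.hasNoRotationUpTo θ) hfin hS ha hb

theorem theorem2 {H : Type*} [Group H] (B : Subgroup H) [B.Normal]
    (θ : (⊤ : Subgroup H) ≃* B) (p : ℕ) (hp : p.Prime) (hB : B.index = p)
    [Group.FG (HNNExtension H ⊤ B θ)] :
    (p = 2 →
      (1 + Real.sqrt 5) / 2 ≤ GroupGrowth.minGrowthRate (HNNExtension H ⊤ B θ)) ∧
    (∀ k : ℕ, p = 2 * k + 1 →
      GroupGrowth.omegaRoot k ≤ GroupGrowth.minGrowthRate (HNNExtension H ⊤ B θ)) := by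
  refine (theorem2_general B (GroupGrowth.ne_top_of_index_eq_prime hp hB) θ).imp
    (fun h _ => h) fun h k hk => h k ?_ ?_
  · have := hp.two_le
    omega
  · exact GroupGrowth.isIsolatedUpTo_of_index_eq_prime hp hB (by omega)
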